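/- Let $\varphi:(0,\infty)\to(0,\infty)$ satisfy: (i) $\varphi\in C^1((0,\infty))$; (ii) $(s\varphi(s))'>0$ for all $s>0$; (iii) the range of $s\mapsto s\varphi(s)$ on $(0,\infty)$ is $(0,\infty)$; (iv) there are constants $C_1,C_2,s_0>0$ and $r>-1$ with $C_1s^r\le (s\varphi(s))'\le C_2s^r$ for $0<s<s_0$, and, if $r=0$, moreover $\lim_{s\to0^+}\varphi(s)$ exists, is finite and positive, and $\lim_{s\to0^+}s\varphi'(s)=0$; (v) there is $s_1>s_0$ such that either $\varphi'\ge0$ on $[s_1,\infty)$ or $\varphi'\le0$ on $[s_1,\infty)$; (vi) $s\mapsto|s\varphi'(s)/\varphi(s)|$ is non-decreasing on $(0,\infty)$. Let $\Lambda:(0,\infty)\to\mathbb R$ be the function defined by $$\Lambda\bigl(s\sqrt{\varphi(s)}\bigr)=-\frac{s\varphi'(s)}{s\varphi'(s)+2\varphi(s)},\qquad s>0 .$$ Let $(a,b)\subset\mathbb R$ be a bounded or unbounded open interval, and let $\mathscr A(x)=\{a_{ij}(x)\}$ be an $m\times m$ matrix with complex entries $a_{ij}\in L^1_{loc}((a,b))$.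 Write $\langle\xi,\eta\rangle=\sum_j\xi_j\overline{\eta_j}$ on $\mathbb C^m$. The operator $Au=(\mathscr A(x)u')'$ is called $L^\Phi$-dissipative if $$\operatorname{Re}\int_a^b\langle\mathscr A\,u',(\varphi(|u|)u)'\rangle\,dx\ge0$$ for every $u\in[C^1_c((a,b))]^m$ such that $\varphi(|u|)u\in[C^1_c((a,b))]^m$, where $\varphi(|u|)u$ is understood as $0$ wherever $u=0$. Then the finite limit $\Lambda_\infty=\lim_{t\to\infty}\Lambda(t)$ exists, and $A$ is $L^\Phi$-dissipative if and only if, for almost every $x\in(a,b)$ and for all $\lambda,\omega\in\mathbb C^m$ with $|\omega|=1$, $$\operatorname{Re}\langle\mathscr A(x)\lambda,\lambda\rangle-\Lambda_\infty^2\operatorname{Re}\langle\mathscr A(x)\omega,\omega\rangle(\operatorname{Re}\langle\lambda,\omega\rangle)^2+\Lambda_\infty\operatorname{Re}\bigl(\langle\mathscr A(x)\omega,\lambda\rangle-\langle\mathscr A(x)\lambda,\omega\rangle\bigr)\operatorname{Re}\langle\lambda,\omega\rangle\ge0 .$$ -/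

import Mathlib

open Set Filter Topology MeasureTheory

noncomputable section

namespace FunctionalDissipativity

/-- The standing assumptions on the positive function `φ : (0,∞) → (0,∞)`.  Only the values of `φ`
on `(0,∞)` matter; `φ` is represented by a function on `ℝ`. -/
structure Admissible (φ : ℝ → ℝ) : Prop where
  pos : ∀ s, 0 < s → 0 < φ s
  contDiffOn : ContDiffOn ℝ 1 φ (Ioi 0)
  deriv_pos : ∀ s, 0 < s → 0 < deriv (fun t => t * φ t) s
  range_eq : (fun s => s * φ s) '' Ioi 0 = Ioi 0
  /-- Behaviour near `0` (with the supplementary requirement when `r = 0`), and constant sign of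
  `φ'` near infinity. -/
  growth : ∃ C₁ C₂ r s₀ : ℝ, 0 < C₁ ∧ 0 < C₂ ∧ -1 < r ∧ 0 < s₀ ∧
    (∀ s ∈ Ioo 0 s₀, C₁ * s ^ r ≤ deriv (fun t => t * φ t) s ∧
      deriv (fun t => t * φ t) s ≤ C₂ * s ^ r) ∧
    (r = 0 → (∃ l : ℝ, 0 < l ∧ Tendsto φ (𝓝[>] 0) (𝓝 l)) ∧
      Tendsto (fun s => s * deriv φ s) (𝓝[>] 0) (𝓝 0)) ∧
    ∃ s₁, s₀ < s₁ ∧ ((∀ s, s₁ ≤ s → 0 ≤ deriv φ s) ∨ (∀ s, s₁ ≤ s → deriv φ s ≤ 0))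
  monotone_abs : MonotoneOn (fun s => |s * deriv φ s / φ s|) (Ioi 0)

/-- The inverse of the function `s ↦ s √(φ s)` on `(0,∞)`. -/
def invMulSqrt (φ : ℝ → ℝ) : ℝ → ℝ :=
  Function.invFunOn (fun s => s * √(φ s)) (Ioi 0)

/-- The function `Λ` on `(0,∞)`, given by
`Λ (s √(φ s)) = - s φ'(s) / (s φ'(s) + 2 φ(s))` for `s > 0`; see `Lambda_mul_sqrt`. -/
def Lambda (φ : ℝ → ℝ) (t : ℝ) : ℝ :=
  -(invMulSqrt φ t * deriv φ (invMulSqrt φ t)) /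
    (invMulSqrt φ t * deriv φ (invMulSqrt φ t) + 2 * φ (invMulSqrt φ t))

theorem Admissible.strictMonoOn_mul_sqrt {φ : ℝ → ℝ} (hφ : Admissible φ) :
    StrictMonoOn (fun s => s * √(φ s)) (Ioi 0) := by
  have hm : StrictMonoOn (fun s => s * φ s) (Ioi 0) := by
    apply strictMonoOn_of_deriv_pos (convex_Ioi 0)
    · exact continuousOn_id.mul hφ.contDiffOn.continuousOn
    · intro x hx
      rw [interior_Ioi] at hx
      exact hφ.deriv_pos x hx
  intro x hx y hy hxy
  have hx0 : 0 < x := hx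
  have hy0 : 0 < y := hy
  have h1 : x * φ x < y * φ y := hm hx hy hxy
  have h0 : 0 < x * φ x := mul_pos hx0 (hφ.pos x hx0)
  have e : ∀ s, 0 < s → s * √(φ s) = √(s * (s * φ s)) := by
    intro s hs
    rw [← mul_assoc, Real.sqrt_mul (mul_self_nonneg s), Real.sqrt_mul_self hs.le]
  change x * √(φ x) < y * √(φ y)
  rw [e x hx0, e y hy0]
  exact Real.sqrt_lt_sqrt (mul_pos hx0 h0).le (mul_lt_mul'' hxy h1 hx0.le h0.le)

/-- The defining relation of `Λ`. -/
theorem Admissible.Lambda_mul_sqrt {φ : ℝ → ℝ} (hφ : Admissible φ) {s : ℝ} (hs : 0 < s) :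
    Lambda φ (s * √(φ s)) = -(s * deriv φ s) / (s * deriv φ s + 2 * φ s) := by
  have h : invMulSqrt φ (s * √(φ s)) = s :=
    hφ.strictMonoOn_mul_sqrt.injOn.leftInvOn_invFunOn (show s ∈ Ioi (0 : ℝ) from hs)
  simp only [Lambda, h]

/-- The bounded or unbounded open interval `(a,b) ⊆ ℝ`, with `a, b ∈ [-∞, +∞]`. -/
def openInterval (a b : EReal) : Set ℝ := {x : ℝ | a < (x : EReal) ∧ (x : EReal) < b}

/-- `ℂ^m` with its Euclidean norm. -/
abbrev Cvec (m : ℕ) : Type := EuclideanSpace ℂ (Fin m)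

/-- The scalar product `⟨x, y⟩ = ∑ j, x j * conj (y j)`, linear in the first argument. -/
def sprod {m : ℕ} (x y : Cvec m) : ℂ := inner ℂ y x

/-- The matrix-vector product `M v`. -/
def matVec {m : ℕ} (M : Matrix (Fin m) (Fin m) ℂ) (v : Cvec m) : Cvec m :=
  WithLp.toLp 2 (M.mulVec v.ofLp)

/-- `u ∈ [C_c^1(I)]^m`: continuously differentiable, with compact support contained in `I`
(`u` is identified with its extension by zero). -/
def IsTestFun {m : ℕ} (I : Set ℝ) (u : ℝ → Cvec m) : Prop :=
  ContDiff ℝ 1 u ∧ HasCompactSupport u ∧ tsupport u ⊆ I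

/-- `φ(|u|) u`, which is zero where `u` vanishes. -/
def weighted {m : ℕ} (φ : ℝ → ℝ) (u : ℝ → Cvec m) : ℝ → Cvec m :=
  fun x => φ ‖u x‖ • u x

/-- `L^Φ`-dissipativity of the operator `u ↦ (𝒜 u')'` on the interval `I`:
`Re ∫_I ⟨𝒜 u', (φ(|u|) u)'⟩ dx ≥ 0` for all `u ∈ [C_c^1(I)]^m` with `φ(|u|) u ∈ [C_c^1(I)]^m`. -/
def IsDissipative {m : ℕ} (φ : ℝ → ℝ) (I : Set ℝ) (𝒜 : ℝ → Matrix (Fin m) (Fin m) ℂ) : Prop :=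
  ∀ u : ℝ → Cvec m, IsTestFun I u → IsTestFun I (weighted φ u) →
    0 ≤ (∫ x in I, sprod (matVec (𝒜 x) (deriv u x)) (deriv (weighted φ u) x)).re

end FunctionalDissipativity

end

noncomputable section

namespace FunctionalDissipativity

/-! Everything is governed by the index `p(s) = s φ'(s) / φ(s)`, through `Λ = -p / (p + 2)`.
Positivity of `(s φ)'` says `p > -1`, so `|Λ| ≤ 1`. Since `|p|` is non-decreasing and `p` has one
sign near infinity, `p` has one sign everywhere; hence `Λ` is monotone, converges to some `L`, and
every value is `θ L` with `θ ∈ [0, 1]` (`exists_tendsto_lambdaOfIndex`).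

Where `u = s ω ≠ 0`, the substitution `u' = l + Λ Re⟨l, ω⟩ ω`, invertible in `l`, turns `(φ(|u|)
u)'` into `φ(s) (l - Λ Re⟨l, ω⟩ ω)`. The integrand becomes `φ(s)` times the form of the theorem with
`Λ` in place of `L` (`re_sprod_tangent_polar`).

Sufficiency is then pointwise: nonnegativity of the form at `L` passes to `θ L`
(`dissForm_nonneg_of_mem_segment`), and at zeros of `u` only `Re⟨𝒜 u', u'⟩ ≥ 0` is needed.

For necessity, perturb a cut-off constant `z` by a rapid oscillation of small amplitude along `v`.
The values stay near `z`, while the large derivative makes the cut-off negligible. Averaging,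
Lebesgue differentiation and density give `Re⟨𝒜(x) v, tangent φ z v⟩ ≥ 0` for almost every `x` and
all `z ≠ 0`, `v`; letting `|z| → ∞` replaces `Λ` by `L`. -/

/-- The logarithmic derivative `s φ'(s) / φ(s)` with respect to `log s`. -/
def logIndex (φ : ℝ → ℝ) (s : ℝ) : ℝ := s * deriv φ s / φ s

/-- The value of `Λ` at the point `s √(φ s)`, in terms of the index `p = s φ'(s) / φ(s)`. -/
def lambdaOfIndex (p : ℝ) : ℝ := -p / (p + 2)

theorem lambdaOfIndex_antitoneOn : AntitoneOn lambdaOfIndex (Ioi (-2)) := by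
  intro p hp q hq hpq
  have hp' : 0 < p + 2 := by have : -2 < p := hp; linarith
  have hq' : 0 < q + 2 := by have : -2 < q := hq; linarith
  unfold lambdaOfIndex
  rw [div_le_div_iff₀ hq' hp']
  nlinarith

theorem abs_lambdaOfIndex_le_one {p : ℝ} (hp : -1 < p) : |lambdaOfIndex p| ≤ 1 := by
  have h : 0 < p + 2 := by linarith
  rw [lambdaOfIndex, abs_div, abs_of_pos h, div_le_one h, abs_le]
  constructor <;> linarith

/-! ### The index of `φ` and the limit of `Λ` -/

namespace Admissible

variable {φ : ℝ → ℝ}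

theorem contDiffAt (hφ : Admissible φ) {s : ℝ} (hs : 0 < s) : ContDiffAt ℝ 1 φ s :=
  hφ.contDiffOn.contDiffAt (Ioi_mem_nhds hs)

theorem hasDerivAt (hφ : Admissible φ) {s : ℝ} (hs : 0 < s) : HasDerivAt φ (deriv φ s) s :=
  ((hφ.contDiffAt hs).differentiableAt one_ne_zero).hasDerivAt

theorem continuousOn_deriv (hφ : Admissible φ) : ContinuousOn (deriv φ) (Ioi 0) :=
  hφ.contDiffOn.continuousOn_deriv_of_isOpen isOpen_Ioi le_rfl

theorem deriv_mul_self (hφ : Admissible φ) {s : ℝ} (hs : 0 < s) :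
    deriv (fun t => t * φ t) s = φ s + s * deriv φ s := by
  have h := (hasDerivAt_id' s).fun_mul (hφ.hasDerivAt hs)
  rw [h.deriv, one_mul]

theorem hasDerivAt_mul_self (hφ : Admissible φ) {s : ℝ} (hs : 0 < s) :
    HasDerivAt (fun t => t * φ t) (deriv (fun t => t * φ t) s) s := by
  rw [hφ.deriv_mul_self hs]
  have h := (hasDerivAt_id' s).fun_mul (hφ.hasDerivAt hs)
  rwa [one_mul] at h

theorem continuousOn_deriv_mul_self (hφ : Admissible φ) :
    ContinuousOn (deriv fun t => t * φ t) (Ioi 0) :=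
  (hφ.contDiffOn.continuousOn.add (continuousOn_id.mul hφ.continuousOn_deriv)).congr
    fun _ hs => hφ.deriv_mul_self hs

theorem strictMonoOn_mul_self (hφ : Admissible φ) : StrictMonoOn (fun s => s * φ s) (Ioi 0) := by
  apply strictMonoOn_of_deriv_pos (convex_Ioi 0)
  · exact continuousOn_id.mul hφ.contDiffOn.continuousOn
  · intro x hx
    rw [interior_Ioi] at hx
    exact hφ.deriv_pos x hx

/-- The function is increasing and attains every positive value. -/
theorem tendsto_mul_self_zero (hφ : Admissible φ) :
    Tendsto (fun s => s * φ s) (𝓝[>] 0) (𝓝 0) := by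
  rw [Metric.tendsto_nhds]
  intro ε hε
  obtain ⟨s, hs, hse⟩ : ε ∈ (fun s => s * φ s) '' Ioi 0 := by rw [hφ.range_eq]; exact hε
  filter_upwards [Ioo_mem_nhdsGT (show (0 : ℝ) < s from hs)] with t ht
  have h1 := hφ.strictMonoOn_mul_self ht.1 hs ht.2
  have h2 : 0 < t * φ t := mul_pos ht.1 (hφ.pos t ht.1)
  rw [Real.dist_eq, sub_zero, abs_of_pos h2]
  exact h1.trans_eq hse

theorem neg_one_lt_logIndex (hφ : Admissible φ) {s : ℝ} (hs : 0 < s) : -1 < logIndex φ s := by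
  have h := hφ.deriv_pos s hs
  rw [hφ.deriv_mul_self hs] at h
  rw [logIndex, lt_div_iff₀ (hφ.pos s hs)]
  linarith

theorem continuousOn_logIndex (hφ : Admissible φ) : ContinuousOn (logIndex φ) (Ioi 0) :=
  (continuousOn_id.mul hφ.continuousOn_deriv).div hφ.contDiffOn.continuousOn
    fun s hs => (hφ.pos s hs).ne'

theorem Lambda_eq_lambdaOfIndex (hφ : Admissible φ) {s : ℝ} (hs : 0 < s) :
    Lambda φ (s * √(φ s)) = lambdaOfIndex (logIndex φ s) := by
  have h0 := hφ.pos s hs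
  have h1 := hφ.neg_one_lt_logIndex hs
  rw [hφ.Lambda_mul_sqrt hs, lambdaOfIndex]
  have e : s * deriv φ s = logIndex φ s * φ s := by
    rw [logIndex, div_mul_cancel₀ _ h0.ne']
  rw [e]
  have h2 : logIndex φ s + 2 ≠ 0 := by linarith
  rw [← add_mul, neg_div, neg_div, mul_div_mul_right _ _ h0.ne']

/-- The index has constant sign on the whole half-line. -/
theorem logIndex_sign (hφ : Admissible φ) :
    (∀ s, 0 < s → 0 ≤ logIndex φ s) ∨ (∀ s, 0 < s → logIndex φ s ≤ 0) := by
  obtain ⟨_, _, _, s₀, _, _, _, hs₀, _, _, s₁, hs₁, hsign⟩ := hφ.growth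
  have hs₁0 : 0 < s₁ := hs₀.trans hs₁
  have hmon := hφ.monotone_abs
  -- Monotonicity of the absolute value: a zero at `t` would force a zero at every earlier point. A
  -- change of sign before `s₁` is thus excluded by the intermediate value theorem.
  have key : ∀ s, 0 < s → logIndex φ s ≠ 0 → ∀ t ∈ Icc s s₁, logIndex φ t ≠ 0 := by
    intro s hs hne t ht h0
    have h := hmon (show s ∈ Ioi (0 : ℝ) from hs) (show t ∈ Ioi (0 : ℝ) from hs.trans_le ht.1) ht.1
    change |logIndex φ s| ≤ |logIndex φ t| at h
    rw [h0, abs_zero] at h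
    exact hne (abs_nonpos_iff.mp h)
  have cont : ∀ s, 0 < s → ContinuousOn (logIndex φ) (Icc s s₁) := fun s hs =>
    hφ.continuousOn_logIndex.mono fun t ht => hs.trans_le ht.1
  rcases hsign with h | h
  · left
    have hbig : ∀ s, s₁ ≤ s → 0 ≤ logIndex φ s := fun s hs =>
      div_nonneg (mul_nonneg (hs₁0.le.trans hs) (h s hs)) (hφ.pos s (hs₁0.trans_le hs)).le
    intro s hs
    by_contra! hneg
    have hlt : s ≤ s₁ := by
      by_contra! hc
      exact absurd (hbig s hc.le) (not_le.mpr hneg)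
    obtain ⟨t, ht, ht0⟩ := intermediate_value_Icc hlt (cont s hs)
      (show (0 : ℝ) ∈ Icc _ _ from ⟨hneg.le, hbig s₁ le_rfl⟩)
    exact key s hs hneg.ne t ht ht0
  · right
    have hbig : ∀ s, s₁ ≤ s → logIndex φ s ≤ 0 := fun s hs =>
      div_nonpos_of_nonpos_of_nonneg
        (mul_nonpos_of_nonneg_of_nonpos (hs₁0.le.trans hs) (h s hs)) (hφ.pos s (hs₁0.trans_le hs)).le
    intro s hs
    by_contra! hneg
    have hlt : s ≤ s₁ := by
      by_contra! hc
      exact absurd (hbig s hc.le) (not_le.mpr hneg)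
    obtain ⟨t, ht, ht0⟩ := intermediate_value_Icc' hlt (cont s hs)
      (show (0 : ℝ) ∈ Icc _ _ from ⟨hbig s₁ le_rfl, hneg.le⟩)
    exact key s hs hneg.ne' t ht ht0

/-- The values `Λ (s √(φ s))` converge as `s → ∞`, and lie between `0` and their limit. -/
theorem exists_tendsto_lambdaOfIndex (hφ : Admissible φ) :
    ∃ L : ℝ, Tendsto (fun s => lambdaOfIndex (logIndex φ s)) atTop (𝓝 L) ∧
      ∀ s, 0 < s → ∃ θ ∈ Icc (0 : ℝ) 1, lambdaOfIndex (logIndex φ s) = θ * L := by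
  set f : ℝ → ℝ := fun s => lambdaOfIndex (logIndex φ s) with hf
  have hp : ∀ s, 0 < s → logIndex φ s ∈ Ioi (-2 : ℝ) := fun s hs => by
    have := hφ.neg_one_lt_logIndex hs
    show (-2 : ℝ) < _
    linarith
  have hb : ∀ s, 0 < s → |f s| ≤ 1 := fun s hs =>
    abs_lambdaOfIndex_le_one (hφ.neg_one_lt_logIndex hs)
  have hmon := hφ.monotone_abs
  suffices h : ∃ L, Tendsto f atTop (𝓝 L) ∧
      ((∀ s, 0 < s → 0 ≤ f s ∧ f s ≤ L) ∨ (∀ s, 0 < s → L ≤ f s ∧ f s ≤ 0)) by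
    obtain ⟨L, hL, hs⟩ := h
    refine ⟨L, hL, fun s hs0 => ?_⟩
    rcases eq_or_ne L 0 with rfl | hL0
    · refine ⟨0, by simp, ?_⟩
      rcases hs with h | h <;> have := h s hs0 <;> simp <;> linarith
    · refine ⟨f s / L, ?_, by rw [div_mul_cancel₀ _ hL0]⟩
      rcases hs with h | h <;> obtain ⟨h1, h2⟩ := h s hs0
      · have : 0 < L := lt_of_le_of_ne (h1.trans h2) hL0.symm
        exact ⟨by positivity, (div_le_one this).mpr h2⟩
      · have : L < 0 := lt_of_le_of_ne (h1.trans h2) hL0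
        exact ⟨div_nonneg_of_nonpos h2 this.le, (div_le_one_of_neg this).mpr h1⟩
  -- Freezing the argument below `1` gives a monotone function on all of `ℝ` with the same limit.
  have ext : ∀ g : ℝ → ℝ, MonotoneOn g (Ioi 0) → (∀ s, 0 < s → |g s| ≤ 1) →
      ∃ L, Tendsto g atTop (𝓝 L) ∧ ∀ s, 0 < s → g s ≤ L := by
    intro g hg hgb
    have hm : Monotone fun s => g (max s 1) := fun s t hst =>
      hg (show (0 : ℝ) < _ by positivity) (show (0 : ℝ) < _ by positivity)
        (max_le_max_right 1 hst)
    have hbd : BddAbove (range fun s => g (max s 1)) := by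
      refine ⟨1, ?_⟩
      rintro _ ⟨s, rfl⟩
      exact (abs_le.mp (hgb _ (by positivity))).2
    have ht := tendsto_atTop_ciSup hm hbd
    refine ⟨_, ht.congr' ?_, fun s hs => ?_⟩
    · filter_upwards [eventually_ge_atTop 1] with s hs
      rw [max_eq_left hs]
    · exact (hg hs (show (0 : ℝ) < _ by positivity) (le_max_left s 1)).trans (le_ciSup hbd s)
  rcases hφ.logIndex_sign with h | h
  · have hanti : AntitoneOn f (Ioi 0) := fun s hs t ht hst => by
      refine lambdaOfIndex_antitoneOn (hp s hs) (hp t ht) ?_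
      have h2 := hmon hs ht hst
      change |logIndex φ s| ≤ |logIndex φ t| at h2
      rwa [abs_of_nonneg (h s hs), abs_of_nonneg (h t ht)] at h2
    obtain ⟨L, hL, hle⟩ := ext (fun s => -f s) hanti.neg (fun s hs => by simpa using hb s hs)
    refine ⟨-L, by simpa using hL.neg, Or.inr fun s hs => ⟨by linarith [hle s hs], ?_⟩⟩
    exact div_nonpos_of_nonpos_of_nonneg (by linarith [h s hs]) (by linarith [h s hs])
  · have hanti : MonotoneOn f (Ioi 0) := fun s hs t ht hst => by
      refine lambdaOfIndex_antitoneOn (hp t ht) (hp s hs) ?_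
      have h2 := hmon hs ht hst
      change |logIndex φ s| ≤ |logIndex φ t| at h2
      rw [abs_of_nonpos (h s hs), abs_of_nonpos (h t ht)] at h2
      linarith
    obtain ⟨L, hL, hle⟩ := ext f hanti hb
    refine ⟨L, hL, Or.inl fun s hs => ⟨?_, hle s hs⟩⟩
    exact div_nonneg (by linarith [h s hs]) (by linarith [hφ.neg_one_lt_logIndex hs])

theorem tendsto_mul_sqrt_atTop (hφ : Admissible φ) :
    Tendsto (fun s => s * √(φ s)) atTop atTop := by
  have h1 : 0 < φ 1 := hφ.pos 1 one_pos
  have hlim : Tendsto (fun s => √(s * φ 1)) atTop atTop :=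
    Real.tendsto_sqrt_atTop.comp (tendsto_id.atTop_mul_const h1)
  refine tendsto_atTop_mono' _ ?_ hlim
  filter_upwards [eventually_ge_atTop 1] with s hs
  have hs0 : 0 < s := by linarith
  have e : s * √(φ s) = √(s * (s * φ s)) := by
    rw [← mul_assoc, Real.sqrt_mul (mul_self_nonneg s), Real.sqrt_mul_self hs0.le]
  rw [e]
  apply Real.sqrt_le_sqrt
  have := hφ.strictMonoOn_mul_self.monotoneOn (mem_Ioi.mpr one_pos)
    (show s ∈ Ioi (0 : ℝ) from hs0) hs
  have h2 : 1 * φ 1 ≤ s * φ s := this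
  rw [one_mul] at h2
  gcongr

/-- `s √(φ s)` is continuous and tends to infinity, so every large `t` is a value of it at a large
`s`. -/
theorem tendsto_Lambda (hφ : Admissible φ) {L : ℝ}
    (hL : Tendsto (fun s => lambdaOfIndex (logIndex φ s)) atTop (𝓝 L)) :
    Tendsto (Lambda φ) atTop (𝓝 L) := by
  intro U hU
  obtain ⟨S, hS⟩ := mem_atTop_sets.mp (hL hU)
  set S' := max S 1
  have hS'0 : 0 < S' := by positivity
  refine mem_atTop_sets.mpr ⟨S' * √(φ S'), fun t ht => ?_⟩
  obtain ⟨s₂, hs₂t, hs₂⟩ := ((hφ.tendsto_mul_sqrt_atTop.eventually_ge_atTop t).and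
    (eventually_ge_atTop S')).exists
  have hc : ContinuousOn (fun s => s * √(φ s)) (Icc S' s₂) :=
    (continuousOn_id.mul hφ.contDiffOn.continuousOn.sqrt).mono fun s hs => hS'0.trans_le hs.1
  obtain ⟨s, hs, rfl⟩ := intermediate_value_Icc hs₂ hc (show t ∈ Icc _ _ from ⟨ht, hs₂t⟩)
  show Lambda φ (s * √(φ s)) ∈ U
  rw [hφ.Lambda_eq_lambdaOfIndex (hS'0.trans_le hs.1)]
  exact hS s ((le_max_left S 1).trans hs.1)

end Admissible

/-! ### The quadratic form and its polar factorization -/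

variable {m : ℕ}

theorem sprod_add_left (x y z : Cvec m) : sprod (x + y) z = sprod x z + sprod y z :=
  inner_add_right _ _ _

theorem sprod_sub_right (x y z : Cvec m) : sprod x (y - z) = sprod x y - sprod x z :=
  inner_sub_left _ _ _

theorem sprod_smul_left (r : ℝ) (x y : Cvec m) : sprod (r • x) y = r * sprod x y :=
  inner_smul_right_eq_smul _ _ _ |>.trans (Complex.real_smul)

theorem sprod_smul_right (r : ℝ) (x y : Cvec m) : sprod x (r • y) = r * sprod x y := by
  simp [sprod, inner_smul_left_eq_star_smul]

theorem sprod_self (x : Cvec m) : sprod x x = (‖x‖ ^ 2 : ℝ) := by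
  rw [sprod, inner_self_eq_norm_sq_to_K]; norm_cast

theorem matVec_add (M : Matrix (Fin m) (Fin m) ℂ) (x y : Cvec m) :
    matVec M (x + y) = matVec M x + matVec M y := by
  simp [matVec, Matrix.mulVec_add]

theorem matVec_smul (M : Matrix (Fin m) (Fin m) ℂ) (r : ℝ) (x : Cvec m) :
    matVec M (r • x) = r • matVec M x := by
  simp [matVec, Matrix.mulVec_smul]

theorem sprod_matVec_eq_sum (M : Matrix (Fin m) (Fin m) ℂ) (x y : Cvec m) :
    sprod (matVec M x) y = ∑ i, ∑ j, M i j * (x j * (starRingEnd ℂ) (y i)) := by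
  simp only [sprod, matVec, PiLp.inner_apply, RCLike.inner_apply, Matrix.mulVec, dotProduct,
    Finset.sum_mul]
  exact Finset.sum_congr rfl fun i _ => Finset.sum_congr rfl fun j _ => by ring

/-- The entrywise `ℓ¹` size of a matrix. -/
def entrySum (M : Matrix (Fin m) (Fin m) ℂ) : ℝ := ∑ i, ∑ j, ‖M i j‖

theorem norm_sprod_matVec_le (M : Matrix (Fin m) (Fin m) ℂ) (x y : Cvec m) :
    ‖sprod (matVec M x) y‖ ≤ entrySum M * (‖x‖ * ‖y‖) := by
  rw [sprod_matVec_eq_sum, entrySum, Finset.sum_mul]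
  refine (norm_sum_le _ _).trans (Finset.sum_le_sum fun i _ => ?_)
  rw [Finset.sum_mul]
  refine (norm_sum_le _ _).trans (Finset.sum_le_sum fun j _ => ?_)
  rw [norm_mul, norm_mul, RCLike.norm_conj]
  gcongr
  · exact PiLp.norm_apply_le x j
  · exact PiLp.norm_apply_le y i

/-- The quadratic form in the characterization of dissipativity. -/
def dissForm (M : Matrix (Fin m) (Fin m) ℂ) (L : ℝ) (l ω : Cvec m) : ℝ :=
  (sprod (matVec M l) l).re - L ^ 2 * (sprod (matVec M ω) ω).re * (sprod l ω).re ^ 2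
    + L * (sprod (matVec M ω) l - sprod (matVec M l) ω).re * (sprod l ω).re

/-- The form is a single pairing, with opposite corrections along `ω` on its two sides; this is the
shape the integrand takes. -/
theorem dissForm_eq (M : Matrix (Fin m) (Fin m) ℂ) (L : ℝ) (l ω : Cvec m) :
    dissForm M L l ω = (sprod (matVec M (l + (L * (sprod l ω).re) • ω))
      (l - (L * (sprod l ω).re) • ω)).re := by
  simp only [dissForm, matVec_add, matVec_smul, sprod_add_left, sprod_sub_right, sprod_smul_left,
    sprod_smul_right, Complex.add_re, Complex.sub_re, Complex.re_ofReal_mul]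
  ring

/-- The real derivative of `z ↦ φ(|z|) z` at `z ≠ 0` in the direction `v`. -/
def tangent (φ : ℝ → ℝ) (z v : Cvec m) : Cvec m :=
  φ ‖z‖ • v + (deriv φ ‖z‖ / ‖z‖ * (sprod v z).re) • z

theorem tangent_smul (φ : ℝ → ℝ) (z : Cvec m) (r : ℝ) (v : Cvec m) :
    tangent φ z (r • v) = r • tangent φ z v := by
  simp only [tangent, sprod_smul_left, Complex.re_ofReal_mul, smul_add, smul_smul]
  congr 2 <;> ring

/-- The radial part of the derivative is stretched by `1 + p` relative to the rest, and `Λ = -p / (p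
+ 2)` is the solution of `(1 + p)(1 + Λ) = 1 - Λ`. -/
theorem tangent_polar {φ : ℝ → ℝ} (hφ : Admissible φ) {s : ℝ} (hs : 0 < s) {ω : Cvec m}
    (hω : ‖ω‖ = 1) (l : Cvec m) :
    tangent φ (s • ω) (l + (lambdaOfIndex (logIndex φ s) * (sprod l ω).re) • ω) =
      φ s • (l - (lambdaOfIndex (logIndex φ s) * (sprod l ω).re) • ω) := by
  have hns : ‖s • ω‖ = s := by rw [norm_smul, hω, mul_one, Real.norm_of_nonneg hs.le]
  have h0 := hφ.pos s hs
  have h1 : s * deriv φ s = logIndex φ s * φ s := by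
    rw [logIndex, div_mul_cancel₀ _ h0.ne']
  have h2 : logIndex φ s + 2 ≠ 0 := by linarith [hφ.neg_one_lt_logIndex hs]
  have h3 : deriv φ s = logIndex φ s * φ s / s := by rw [← h1]; field_simp
  simp only [tangent, hns, sprod_smul_right, sprod_add_left, sprod_smul_left, sprod_self, hω,
    Complex.add_re, Complex.re_ofReal_mul, Complex.ofReal_re]
  rw [h3, smul_smul, smul_add, smul_sub, smul_smul, add_assoc, ← add_smul,
    sub_eq_add_neg, ← neg_smul]
  congr 2
  simp only [lambdaOfIndex]
  field_simp
  ring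

theorem re_sprod_tangent_polar {φ : ℝ → ℝ} (hφ : Admissible φ) {s : ℝ} (hs : 0 < s) {ω : Cvec m}
    (hω : ‖ω‖ = 1) (M : Matrix (Fin m) (Fin m) ℂ) (l : Cvec m) :
    (sprod (matVec M (l + (lambdaOfIndex (logIndex φ s) * (sprod l ω).re) • ω))
      (tangent φ (s • ω) (l + (lambdaOfIndex (logIndex φ s) * (sprod l ω).re) • ω))).re =
      φ s * dissForm M (lambdaOfIndex (logIndex φ s)) l ω := by
  rw [tangent_polar hφ hs hω, sprod_smul_right, Complex.re_ofReal_mul, dissForm_eq]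

theorem exists_polar_preimage {p : ℝ} (hp : -1 < p) {ω : Cvec m} (hω : ‖ω‖ = 1) (v : Cvec m) :
    ∃ l : Cvec m, l + (lambdaOfIndex p * (sprod l ω).re) • ω = v := by
  -- Along the real line of `ω` the map multiplies by `1 + Λ = 2 / (p + 2)`, whose inverse is `1 + p
  -- / 2`.
  refine ⟨v + (p / 2 * (sprod v ω).re) • ω, ?_⟩
  have h2 : p + 2 ≠ 0 := by linarith
  simp only [sprod_add_left, sprod_smul_left, sprod_self, hω, Complex.add_re,
    Complex.re_ofReal_mul, Complex.ofReal_re]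
  rw [add_assoc, ← add_smul]
  convert add_zero v
  rw [smul_eq_zero]
  left
  simp only [lambdaOfIndex]
  field_simp
  ring

/-- Choose `ω = i l / |l|`: then `Re⟨l, ω⟩ = 0` and only the first term survives. Complex scalars
make this available even for `m = 1`. -/
theorem re_sprod_self_nonneg_of_dissForm_nonneg {M : Matrix (Fin m) (Fin m) ℂ} {L : ℝ}
    (h : ∀ l ω : Cvec m, ‖ω‖ = 1 → 0 ≤ dissForm M L l ω) (l : Cvec m) :
    0 ≤ (sprod (matVec M l) l).re := by
  rcases eq_or_ne l 0 with rfl | hl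
  · simp [sprod]
  have hn : ‖l‖ ≠ 0 := norm_ne_zero_iff.mpr hl
  have hperp : (sprod l ((Complex.I * (‖l‖⁻¹ : ℝ)) • l)).re = 0 := by
    have e := sprod_self l
    simp only [sprod] at e
    simp only [sprod, inner_smul_left, map_mul, Complex.conj_I, Complex.conj_ofReal, e,
      mul_assoc, ← Complex.ofReal_mul, neg_mul, Complex.neg_re, Complex.I_mul_re,
      Complex.ofReal_im, neg_zero]
  have := h l ((Complex.I * (‖l‖⁻¹ : ℝ)) • l) (by
    rw [norm_smul, norm_mul, Complex.norm_I, one_mul, Complex.norm_real, norm_inv, norm_norm,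
      inv_mul_cancel₀ hn])
  rw [dissForm, hperp] at this
  simpa using this

/-- The form is concave in `L`, being quadratic with leading coefficient `-Re⟨M ω, ω⟩ (Re⟨l, ω⟩)² ≤
0`, and it is nonnegative at both `0` and `L`. -/
theorem dissForm_nonneg_of_mem_segment {M : Matrix (Fin m) (Fin m) ℂ} {L θ : ℝ}
    (hθ : θ ∈ Icc (0 : ℝ) 1) (h : ∀ l ω : Cvec m, ‖ω‖ = 1 → 0 ≤ dissForm M L l ω)
    {l ω : Cvec m} (hω : ‖ω‖ = 1) : 0 ≤ dissForm M (θ * L) l ω := by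
  have h1 := h l ω hω
  have h2 := re_sprod_self_nonneg_of_dissForm_nonneg h l
  have h3 := re_sprod_self_nonneg_of_dissForm_nonneg h ω
  have e : dissForm M (θ * L) l ω = (1 - θ) * (sprod (matVec M l) l).re + θ * dissForm M L l ω
      + θ * (1 - θ) * (L ^ 2 * (sprod (matVec M ω) ω).re * (sprod l ω).re ^ 2) := by
    simp only [dissForm]; ring
  rw [e]
  have := hθ.1
  have := sub_nonneg.mpr hθ.2
  positivity

theorem re_sprod_tangent_nonneg {φ : ℝ → ℝ} (hφ : Admissible φ) {M : Matrix (Fin m) (Fin m) ℂ}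
    {L : ℝ} (hL : ∀ s, 0 < s → ∃ θ ∈ Icc (0 : ℝ) 1, lambdaOfIndex (logIndex φ s) = θ * L)
    (h : ∀ l ω : Cvec m, ‖ω‖ = 1 → 0 ≤ dissForm M L l ω) {z : Cvec m} (hz : z ≠ 0) (v : Cvec m) :
    0 ≤ (sprod (matVec M v) (tangent φ z v)).re := by
  have hn : 0 < ‖z‖ := norm_pos_iff.mpr hz
  have hω : ‖(‖z‖⁻¹ : ℝ) • z‖ = 1 := by
    rw [norm_smul, norm_inv, norm_norm, inv_mul_cancel₀ hn.ne']
  have hzω : ‖z‖ • (‖z‖⁻¹ : ℝ) • z = z := by rw [smul_smul, mul_inv_cancel₀ hn.ne', one_smul]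
  obtain ⟨l, hl⟩ := exists_polar_preimage (hφ.neg_one_lt_logIndex hn) hω v
  have := re_sprod_tangent_polar hφ hn hω M l
  rw [hl, hzω] at this
  rw [this]
  obtain ⟨θ, hθ, e⟩ := hL _ hn
  rw [e]
  exact mul_nonneg (hφ.pos _ hn).le (dissForm_nonneg_of_mem_segment hθ h hω)

theorem dissForm_nonneg_of_tangent {φ : ℝ → ℝ} (hφ : Admissible φ)
    {M : Matrix (Fin m) (Fin m) ℂ} {L : ℝ}
    (hL : Tendsto (fun s => lambdaOfIndex (logIndex φ s)) atTop (𝓝 L))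
    (h : ∀ z v : Cvec m, z ≠ 0 → 0 ≤ (sprod (matVec M v) (tangent φ z v)).re)
    (l : Cvec m) {ω : Cvec m} (hω : ‖ω‖ = 1) : 0 ≤ dissForm M L l ω := by
  have hc : Continuous fun L => dissForm M L l ω := by
    unfold dissForm
    fun_prop
  refine ge_of_tendsto ((hc.tendsto L).comp hL) ?_
  filter_upwards [eventually_gt_atTop 0] with s hs
  have hω0 : ω ≠ 0 := fun h => by simp [h] at hω
  have := h (s • ω) (l + (lambdaOfIndex (logIndex φ s) * (sprod l ω).re) • ω)
    (smul_ne_zero hs.ne' hω0)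
  rw [re_sprod_tangent_polar hφ hs hω] at this
  exact nonneg_of_mul_nonneg_right this (hφ.pos s hs)

/-! ### Differentiating `φ(|u|) u`, and sufficiency -/

theorem isOpen_openInterval (a b : EReal) : IsOpen (openInterval a b) :=
  (isOpen_lt continuous_const continuous_coe_real_ereal).inter
    (isOpen_lt continuous_coe_real_ereal continuous_const)

theorem real_inner_eq_re_sprod (x y : Cvec m) : inner ℝ x y = (sprod y x).re := by
  simp only [sprod, PiLp.inner_apply, Complex.re_sum, RCLike.inner_apply]
  exact Finset.sum_congr rfl fun i _ => by simp [Complex.inner, mul_comm]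

theorem hasDerivAt_norm_of_ne_zero {u : ℝ → Cvec m} {u' : Cvec m} {x : ℝ} (hu : HasDerivAt u u' x)
    (h0 : u x ≠ 0) : HasDerivAt (fun y => ‖u y‖) ((sprod u' (u x)).re / ‖u x‖) x := by
  have hn : ‖u x‖ ≠ 0 := norm_ne_zero_iff.mpr h0
  have h1 : HasDerivAt (fun y => ‖u y‖ ^ 2) (2 * (sprod u' (u x)).re) x := by
    have := hu.norm_sq
    rwa [real_inner_eq_re_sprod] at this
  have h2 := h1.sqrt (pow_ne_zero 2 hn)
  simp only [Real.sqrt_sq (norm_nonneg _)] at h2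
  convert h2 using 1
  field_simp

theorem Admissible.hasDerivAt_weighted {φ : ℝ → ℝ} (hφ : Admissible φ) {u : ℝ → Cvec m}
    {u' : Cvec m} {x : ℝ} (hu : HasDerivAt u u' x) (h0 : u x ≠ 0) :
    HasDerivAt (weighted φ u) (tangent φ (u x) u') x := by
  have hn : 0 < ‖u x‖ := norm_pos_iff.mpr h0
  have h1 : HasDerivAt (weighted φ u)
      (φ ‖u x‖ • u' + (deriv φ ‖u x‖ * ((sprod u' (u x)).re / ‖u x‖)) • u x) x :=
    ((hφ.hasDerivAt hn).comp x (hasDerivAt_norm_of_ne_zero hu h0)).smul hu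
  rwa [mul_div_assoc', mul_div_right_comm] at h1

theorem Admissible.contDiffAt_weighted {φ : ℝ → ℝ} (hφ : Admissible φ) {u : ℝ → Cvec m} {x : ℝ}
    (hu : ContDiffAt ℝ 1 u x) (h0 : u x ≠ 0) : ContDiffAt ℝ 1 (weighted φ u) x :=
  ((hφ.contDiffAt (norm_pos_iff.mpr h0)).comp x (hu.norm ℂ h0)).smul hu

/-- At a zero of `u`, the derivative of `φ(|u|) u` is a nonnegative multiple of `u'`,
unless `u'` vanishes. -/
theorem exists_deriv_weighted_eq_smul {φ : ℝ → ℝ} (hφ : Admissible φ) {u : ℝ → Cvec m}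
    {u' w' : Cvec m} {x : ℝ} (hu : HasDerivAt u u' x) (hw : HasDerivAt (weighted φ u) w' x)
    (h0 : u x = 0) (hu' : u' ≠ 0) : ∃ c : ℝ, 0 ≤ c ∧ w' = c • u' := by
  have hn : ‖u'‖ ≠ 0 := norm_ne_zero_iff.mpr hu'
  have hw0 : weighted φ u x = 0 := by simp [weighted, h0]
  have hu1 := hasDerivAt_iff_tendsto_slope.mp hu
  have hw1 := hasDerivAt_iff_tendsto_slope.mp hw
  refine ⟨‖w'‖ / ‖u'‖, by positivity, ?_⟩
  -- Near `x` the slope of `φ(|u|) u` is `φ(|u y|)` times that of `u`, so this positive factor is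
  -- the ratio of the norms of the slopes and converges.
  have hlim := ((hw1.norm.div hu1.norm hn).smul hu1)
  refine tendsto_nhds_unique hw1 (hlim.congr' ?_)
  have hne : ∀ᶠ y in 𝓝[≠] x, slope u x y ≠ 0 := hu1.eventually_ne hu'
  filter_upwards [hne] with y hy
  have huy : u y ≠ 0 := fun h => hy (by simp [slope, h, h0])
  have hφy := hφ.pos _ (norm_pos_iff.mpr huy)
  have hsl : slope (weighted φ u) x y = φ ‖u y‖ • slope u x y := by
    simp only [slope, hw0, h0, vsub_eq_sub, sub_zero]
    rw [weighted, smul_comm]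
  simp only [Pi.div_apply, hsl, norm_smul, Real.norm_of_nonneg hφy.le]
  rw [mul_div_cancel_right₀ _ (norm_ne_zero_iff.mpr hy)]

theorem re_sprod_deriv_weighted_nonneg {φ : ℝ → ℝ} (hφ : Admissible φ)
    {M : Matrix (Fin m) (Fin m) ℂ} {L : ℝ}
    (hL : ∀ s, 0 < s → ∃ θ ∈ Icc (0 : ℝ) 1, lambdaOfIndex (logIndex φ s) = θ * L)
    (h : ∀ l ω : Cvec m, ‖ω‖ = 1 → 0 ≤ dissForm M L l ω) {u : ℝ → Cvec m}
    (hu : Differentiable ℝ u) (hw : Differentiable ℝ (weighted φ u)) (x : ℝ) :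
    0 ≤ (sprod (matVec M (deriv u x)) (deriv (weighted φ u) x)).re := by
  by_cases h0 : u x = 0
  · by_cases hu' : deriv u x = 0
    · simp [hu', sprod, matVec]
    · obtain ⟨c, hc, e⟩ := exists_deriv_weighted_eq_smul hφ (hu x).hasDerivAt (hw x).hasDerivAt
        h0 hu'
      rw [e, sprod_smul_right, Complex.re_ofReal_mul]
      exact mul_nonneg hc (re_sprod_self_nonneg_of_dissForm_nonneg h _)
  · rw [(hφ.hasDerivAt_weighted (hu x).hasDerivAt h0).deriv]
    exact re_sprod_tangent_nonneg hφ hL h h0 _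

theorem integrableOn_sprod_matVec {I : Set ℝ} {𝒜 : ℝ → Matrix (Fin m) (Fin m) ℂ}
    (h𝒜 : ∀ i j, LocallyIntegrableOn (fun x => 𝒜 x i j) I volume) {K : Set ℝ} (hK : IsCompact K)
    (hKI : K ⊆ I) {f g : ℝ → Cvec m} (hf : ContinuousOn f K) (hg : ContinuousOn g K) :
    IntegrableOn (fun x => sprod (matVec (𝒜 x) (f x)) (g x)) K := by
  simp only [sprod_matVec_eq_sum]
  refine integrable_finsetSum _ fun i _ => integrable_finsetSum _ fun j _ => ?_
  refine ((h𝒜 i j).integrableOn_compact_subset hKI hK).mul_continuousOn ?_ hK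
  have h1 : ContinuousOn (fun x => f x j) K :=
    (EuclideanSpace.proj (𝕜 := ℂ) j).continuous.comp_continuousOn hf
  have h2 : ContinuousOn (fun x => g x i) K :=
    (EuclideanSpace.proj (𝕜 := ℂ) i).continuous.comp_continuousOn hg
  exact h1.mul (Complex.continuous_conj.comp_continuousOn h2)

theorem integrableOn_entrySum {I : Set ℝ} {𝒜 : ℝ → Matrix (Fin m) (Fin m) ℂ}
    (h𝒜 : ∀ i j, LocallyIntegrableOn (fun x => 𝒜 x i j) I volume) {K : Set ℝ} (hK : IsCompact K)
    (hKI : K ⊆ I) : IntegrableOn (fun x => entrySum (𝒜 x)) K :=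
  integrable_finsetSum _ fun i _ => integrable_finsetSum _ fun j _ =>
    ((h𝒜 i j).integrableOn_compact_subset hKI hK).norm

theorem integrableOn_dissipativity_integrand {I : Set ℝ} {𝒜 : ℝ → Matrix (Fin m) (Fin m) ℂ}
    (h𝒜 : ∀ i j, LocallyIntegrableOn (fun x => 𝒜 x i j) I volume) {u w : ℝ → Cvec m}
    (hu : IsTestFun I u) (hw : IsTestFun I w) :
    IntegrableOn (fun x => sprod (matVec (𝒜 x) (deriv u x)) (deriv w x)) I := by
  have h1 := integrableOn_sprod_matVec h𝒜 (show IsCompact (tsupport u) from hu.2.1) hu.2.2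
    (hu.1.continuous_deriv le_rfl).continuousOn (hw.1.continuous_deriv le_rfl).continuousOn
  refine (h1.integrable_of_forall_notMem_eq_zero fun x hx => ?_).integrableOn
  have : deriv u x = 0 := image_eq_zero_of_notMem_tsupport fun h => hx (tsupport_deriv_subset h)
  simp [this, sprod, matVec]

theorem isDissipative_of_dissForm_nonneg {φ : ℝ → ℝ} (hφ : Admissible φ) {L : ℝ}
    (hL : ∀ s, 0 < s → ∃ θ ∈ Icc (0 : ℝ) 1, lambdaOfIndex (logIndex φ s) = θ * L)
    {I : Set ℝ} (hI : MeasurableSet I) {𝒜 : ℝ → Matrix (Fin m) (Fin m) ℂ}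
    (h𝒜 : ∀ i j, LocallyIntegrableOn (fun x => 𝒜 x i j) I volume)
    (h : ∀ᵐ x : ℝ, x ∈ I → ∀ l ω : Cvec m, ‖ω‖ = 1 → 0 ≤ dissForm (𝒜 x) L l ω) :
    IsDissipative φ I 𝒜 := by
  intro u hu hw
  have hint := integrableOn_dissipativity_integrand h𝒜 hu hw
  have e := integral_re hint
  simp only [RCLike.re_to_complex] at e
  rw [← e]
  refine integral_nonneg_of_ae ?_
  rw [EventuallyLE, ae_restrict_iff' hI]
  filter_upwards [h] with x hx hxI
  exact re_sprod_deriv_weighted_nonneg hφ hL (hx hxI) (hu.1.differentiable one_ne_zero)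
    (hw.1.differentiable one_ne_zero) x

/-! ### Admissible test functions near a constant -/

/-- For a suitable even exponent `k`, composing `s φ(s)` with `R t ^ k` gives a `C¹` function on the
whole line. -/
theorem Admissible.exists_contDiff_profile {φ : ℝ → ℝ} (hφ : Admissible φ) :
    ∃ k : ℕ, k ≠ 0 ∧ ∀ R : ℝ, 0 < R → ContDiff ℝ 1 fun t : ℝ => R * t ^ k * φ (R * t ^ k) := by
  obtain ⟨_, C, r, s₀, _, hC, hr, hs₀, hgr, _⟩ := hφ.growth
  obtain ⟨n, hn⟩ := exists_nat_gt (1 / (1 + r))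
  have hr1 : 0 < 1 + r := by linarith
  rw [div_lt_iff₀ hr1] at hn
  -- Evenness keeps `R t ^ k` positive for `t ≠ 0`; the size gives `k (1 + r) > 1`, so that the
  -- derivative, of order at most `|t| ^ (k r + k - 1)`, vanishes at `0`.
  set k : ℕ := 2 * (n + 1) with hk
  have hkev : Even k := ⟨n + 1, by omega⟩
  have hk1 : k - 1 ≠ 0 := by omega
  refine ⟨k, by omega, fun R hR => ?_⟩
  have hpos : ∀ t : ℝ, t ≠ 0 → 0 < R * t ^ k := fun t ht => mul_pos hR (hkev.pow_pos ht)
  set G : ℝ → ℝ := fun s => s * φ s with hG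
  set g : ℝ → ℝ := fun t => deriv G (R * t ^ k) * (R * (k * t ^ (k - 1))) with hg
  have hderiv : ∀ t ≠ 0, HasDerivAt (fun t : ℝ => R * t ^ k * φ (R * t ^ k)) (g t) t := fun t ht =>
    HasDerivAt.comp (h₂ := G) t (hφ.hasDerivAt_mul_self (hpos t ht))
      ((hasDerivAt_pow k t).const_mul R)
  have hexp : 0 < (k : ℝ) * r + (k - 1 : ℕ) := by
    rw [Nat.cast_sub (by omega), hk]
    push_cast
    nlinarith
  have hin : Tendsto (fun t : ℝ => R * t ^ k) (𝓝[≠] 0) (𝓝[>] 0) := by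
    refine tendsto_nhdsWithin_iff.mpr ⟨?_, ?_⟩
    · have : Continuous fun t : ℝ => R * t ^ k := by fun_prop
      have h := this.tendsto 0
      rw [zero_pow (by omega), mul_zero] at h
      exact h.mono_left nhdsWithin_le_nhds
    · filter_upwards [self_mem_nhdsWithin] with t ht
      exact hpos t ht
  have hf0 : ContinuousAt (fun t : ℝ => R * t ^ k * φ (R * t ^ k)) 0 := by
    rw [continuousAt_iff_punctured_nhds]
    simp only [zero_pow (show k ≠ 0 by omega), mul_zero, zero_mul]
    exact hφ.tendsto_mul_self_zero.comp hin
  have hg0 : ContinuousAt g 0 := by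
    rw [continuousAt_iff_punctured_nhds]
    have e0 : g 0 = 0 := by simp [hg, hk1]
    rw [e0]
    have hb : ContinuousAt (fun t : ℝ => C * R ^ r * (R * k) * |t| ^ ((k : ℝ) * r + (k - 1 : ℕ))) 0 :=
      ((continuous_abs.rpow_const fun _ => Or.inr hexp.le).const_mul _).continuousAt
    have hb' := hb.tendsto.mono_left (nhdsWithin_le_nhds (s := {0}ᶜ))
    simp only [abs_zero, Real.zero_rpow hexp.ne', mul_zero] at hb'
    refine squeeze_zero_norm' ?_ hb'
    filter_upwards [hin (Ioo_mem_nhdsGT hs₀), self_mem_nhdsWithin] with t ht ht0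
    have ht0 : t ≠ 0 := ht0
    have hta : 0 < |t| := abs_pos.mpr ht0
    have h1 : deriv G (R * t ^ k) ≤ C * (R * t ^ k) ^ r := (hgr _ ht).2
    have h2 : 0 ≤ deriv G (R * t ^ k) := (hφ.deriv_pos _ ht.1).le
    have h3 : (R * t ^ k) ^ r = R ^ r * |t| ^ ((k : ℝ) * r) := by
      rw [← hkev.pow_abs t, Real.mul_rpow hR.le (by positivity), ← Real.rpow_natCast,
        ← Real.rpow_mul hta.le]
    calc ‖g t‖ = deriv G (R * t ^ k) * (R * (k * |t| ^ (k - 1))) := by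
          simp only [hg, norm_mul, Real.norm_eq_abs, abs_pow, abs_of_nonneg h2, abs_of_pos hR,
            Nat.abs_cast]
      _ ≤ C * (R * t ^ k) ^ r * (R * (k * |t| ^ (k - 1))) := by gcongr
      _ = _ := by
          rw [h3, Real.rpow_add hta, Real.rpow_natCast]
          ring
  have hall := hasDerivAt_of_hasDerivAt_of_ne' hderiv hf0 hg0
  rw [contDiff_one_iff_deriv]
  refine ⟨fun t => (hall t).differentiableAt, ?_⟩
  rw [show deriv (fun t : ℝ => R * t ^ k * φ (R * t ^ k)) = g from funext fun t => (hall t).deriv]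
  refine continuous_iff_continuousAt.mpr fun t => ?_
  rcases eq_or_ne t 0 with rfl | ht
  · exact hg0
  · have h1 : ContinuousAt (deriv G) (R * t ^ k) :=
      hφ.continuousOn_deriv_mul_self.continuousAt (Ioi_mem_nhds (hpos t ht))
    have h2 : ContinuousAt (fun t : ℝ => R * t ^ k) t := by fun_prop
    exact (h1.comp_of_eq h2 rfl).mul (by fun_prop)

/-- The constant vector `z`, cut off by a power of the bump function `θ`, plus a perturbation in the
fixed direction `v`. -/
def perturbedBump {c : ℝ} (θ : ContDiffBump c) (k : ℕ) (z v : Cvec m) (S : ℝ → ℝ) (x : ℝ) :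
    Cvec m := θ x ^ k • z + S x • v

section perturbedBump

variable {φ : ℝ → ℝ} {c : ℝ} {θ : ContDiffBump c} {k : ℕ} {z v : Cvec m} {S : ℝ → ℝ}

theorem perturbedBump_eventuallyEq {x : ℝ} (hx : x ∈ Metric.ball c θ.rIn) :
    perturbedBump θ k z v S =ᶠ[𝓝 x] fun y => z + S y • v := by
  filter_upwards [θ.eventuallyEq_one_of_mem_ball hx] with y hy
  simp [perturbedBump, hy]

theorem perturbedBump_eventuallyEq_of_notMem_tsupport {x : ℝ} (hx : x ∉ tsupport S) :
    perturbedBump θ k z v S =ᶠ[𝓝 x] perturbedBump θ k z v 0 := by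
  filter_upwards [notMem_tsupport_iff_eventuallyEq.mp hx] with y hy
  simp [perturbedBump, hy]

theorem add_smul_ne_zero_of_lt {t : ℝ} (h : |t| * ‖v‖ < ‖z‖) : z + t • v ≠ 0 := by
  intro h0
  have : z = -(t • v) := eq_neg_of_add_eq_zero_left h0
  rw [this, norm_neg, norm_smul, Real.norm_eq_abs] at h
  exact lt_irrefl _ h

theorem weighted_eventuallyEq {u₁ u₂ : ℝ → Cvec m} {x : ℝ} (h : u₁ =ᶠ[𝓝 x] u₂) :
    weighted φ u₁ =ᶠ[𝓝 x] weighted φ u₂ := by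
  filter_upwards [h] with y hy
  simp [weighted, hy]

theorem contDiff_perturbedBump (hS : ContDiff ℝ 1 S) :
    ContDiff ℝ 1 (perturbedBump θ k z v S) :=
  ((θ.contDiff.pow k).smul contDiff_const).add (hS.smul contDiff_const)

theorem support_perturbedBump_subset (hk : k ≠ 0) (hSθ : tsupport S ⊆ Metric.ball c θ.rIn) :
    Function.support (perturbedBump θ k z v S) ⊆ Metric.closedBall c θ.rOut := by
  intro x hx
  by_contra hxc
  apply hx
  have h1 : θ x = 0 := θ.zero_of_le_dist (not_le.mp hxc).le
  have h2 : S x = 0 := image_eq_zero_of_notMem_tsupport fun h =>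
    hxc (Metric.ball_subset_closedBall (Metric.ball_subset_ball θ.rIn_lt_rOut.le (hSθ h)))
  simp [perturbedBump, h1, h2, hk]

/-- On the support of `S` the function never vanishes, so the chain rule applies. Elsewhere it is `θ
^ k z`, and the power `k` absorbs the singularity of `φ` at `0`. -/
theorem contDiff_weighted_perturbedBump (hφ : Admissible φ)
    (hprof : ContDiff ℝ 1 fun t : ℝ => ‖z‖ * t ^ k * φ (‖z‖ * t ^ k)) (hz : z ≠ 0)
    (hS : ContDiff ℝ 1 S) (hSθ : tsupport S ⊆ Metric.ball c θ.rIn)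
    (hSz : ∀ x, |S x| * ‖v‖ < ‖z‖) : ContDiff ℝ 1 (weighted φ (perturbedBump θ k z v S)) := by
  rw [contDiff_iff_contDiffAt]
  intro x
  by_cases hx : x ∈ tsupport S
  · refine hφ.contDiffAt_weighted (contDiff_perturbedBump hS).contDiffAt ?_
    rw [(perturbedBump_eventuallyEq (hSθ hx)).eq_of_nhds]
    exact add_smul_ne_zero_of_lt (hSz x)
  · have h1 := weighted_eventuallyEq (φ := φ)
      (perturbedBump_eventuallyEq_of_notMem_tsupport (θ := θ) (k := k) (z := z) (v := v) hx)
    refine ContDiffAt.congr_of_eventuallyEq ?_ h1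
    have h2 : weighted φ (perturbedBump θ k z v 0) =
        fun x => (‖z‖ * θ x ^ k * φ (‖z‖ * θ x ^ k)) • (‖z‖⁻¹ • z) := by
      funext y
      have hn : ‖z‖ ≠ 0 := norm_ne_zero_iff.mpr hz
      have h3 : 0 ≤ θ y ^ k := pow_nonneg θ.nonneg k
      simp only [weighted, perturbedBump, Pi.zero_apply, zero_smul, add_zero, norm_smul,
        Real.norm_of_nonneg h3, smul_smul, mul_comm ‖z‖]
      congr 1
      field_simp
    rw [h2]
    exact ((hprof.comp θ.contDiff).smul contDiff_const).contDiffAt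

theorem isTestFun_of_support_subset {I K : Set ℝ} (hK : IsCompact K) (hKI : K ⊆ I)
    {u : ℝ → Cvec m} (hu : ContDiff ℝ 1 u) (hsupp : Function.support u ⊆ K) : IsTestFun I u :=
  have h : tsupport u ⊆ K := closure_minimal hsupp hK.isClosed
  ⟨hu, hK.of_isClosed_subset (isClosed_tsupport u) h, h.trans hKI⟩

theorem support_weighted_subset (u : ℝ → Cvec m) :
    Function.support (weighted φ u) ⊆ Function.support u := fun x hx h => hx (by simp [weighted, h])

end perturbedBump

/-- The integrand obtained by perturbing the constant function `z` in the direction `v`. -/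
def localForm (φ : ℝ → ℝ) (𝒜 : ℝ → Matrix (Fin m) (Fin m) ℂ) (v z : Cvec m) (x : ℝ) : ℝ :=
  (sprod (matVec (𝒜 x) v) (tangent φ z v)).re

/-- `E` is the contribution outside the small ball. There `S` vanishes, so `E` is the same for all
`S`; this uniformity lets a large `S'` outweigh it. -/
theorem IsDissipative.exists_le_setIntegral {φ : ℝ → ℝ} (hφ : Admissible φ) {I : Set ℝ}
    (hI : MeasurableSet I) {𝒜 : ℝ → Matrix (Fin m) (Fin m) ℂ}
    (h𝒜 : ∀ i j, LocallyIntegrableOn (fun x => 𝒜 x i j) I volume) (hdiss : IsDissipative φ I 𝒜)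
    {c ρ ρ' : ℝ} (hρ : 0 < ρ) (hρρ' : ρ < ρ') (hρI : Metric.closedBall c ρ' ⊆ I) {z : Cvec m}
    (hz : z ≠ 0) (v : Cvec m) :
    ∃ E : ℝ, ∀ S : ℝ → ℝ, ContDiff ℝ 1 S → tsupport S ⊆ Metric.closedBall c ρ →
      (∀ x, |S x| * ‖v‖ < ‖z‖) →
      0 ≤ E + ∫ x in Metric.closedBall c ρ, deriv S x ^ 2 * localForm φ 𝒜 v (z + S x • v) x := by
  obtain ⟨k, hk, hprof⟩ := hφ.exists_contDiff_profile
  let θ : ContDiffBump c := ⟨(ρ + ρ') / 2, ρ', by linarith, by linarith⟩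
  have hball : Metric.closedBall c ρ ⊆ Metric.ball c θ.rIn :=
    Metric.closedBall_subset_ball (show ρ < (ρ + ρ') / 2 by linarith)
  have hKI : Metric.closedBall c ρ ⊆ I := (Metric.closedBall_subset_closedBall hρρ'.le).trans hρI
  let F : (ℝ → ℝ) → ℝ → ℂ := fun S x => sprod (matVec (𝒜 x) (deriv (perturbedBump θ k z v S) x))
    (deriv (weighted φ (perturbedBump θ k z v S)) x)
  refine ⟨(∫ x in I \ Metric.closedBall c ρ, F 0 x).re, fun S hS hSsupp hSz => ?_⟩
  have hSθ := hSsupp.trans hball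
  have hK := isCompact_closedBall c θ.rOut
  have hu : IsTestFun I (perturbedBump θ k z v S) := isTestFun_of_support_subset hK hρI
    (contDiff_perturbedBump hS) (support_perturbedBump_subset hk hSθ)
  have hw : IsTestFun I (weighted φ (perturbedBump θ k z v S)) := isTestFun_of_support_subset hK hρI
    (contDiff_weighted_perturbedBump hφ (hprof _ (norm_pos_iff.mpr hz)) hz hS hSθ hSz)
    ((support_weighted_subset _).trans (support_perturbedBump_subset hk hSθ))
  have hint : IntegrableOn (F S) I := integrableOn_dissipativity_integrand h𝒜 hu hw
  have hnn : 0 ≤ (∫ x in I, F S x).re := hdiss _ hu hw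
  have hmeas : MeasurableSet (Metric.closedBall c ρ) := Metric.isClosed_closedBall.measurableSet
  have hsplit := setIntegral_sdiff (μ := volume) hmeas hint hKI
  have h1 : ∫ x in I \ Metric.closedBall c ρ, F S x = ∫ x in I \ Metric.closedBall c ρ, F 0 x := by
    refine setIntegral_congr_fun (hI.diff hmeas) fun x hx => ?_
    have e := perturbedBump_eventuallyEq_of_notMem_tsupport (θ := θ) (k := k) (z := z) (v := v)
      fun h => hx.2 (hSsupp h)
    simp only [F, e.deriv_eq, (weighted_eventuallyEq (φ := φ) e).deriv_eq]
  have h2 : (∫ x in Metric.closedBall c ρ, F S x).re =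
      ∫ x in Metric.closedBall c ρ, deriv S x ^ 2 * localForm φ 𝒜 v (z + S x • v) x := by
    have e := integral_re (hint.mono_set hKI)
    simp only [RCLike.re_to_complex] at e
    rw [← e]
    refine setIntegral_congr_fun hmeas fun x hx => ?_
    have e1 := perturbedBump_eventuallyEq (θ := θ) (k := k) (z := z) (v := v) (S := S) (hball hx)
    have hne : z + S x • v ≠ 0 := add_smul_ne_zero_of_lt (hSz x)
    have hd : HasDerivAt (fun y => z + S y • v) (deriv S x • v) x :=
      (((hS.differentiable one_ne_zero) x).hasDerivAt.smul_const v).const_add z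
    simp only [F, e1.deriv_eq, (weighted_eventuallyEq (φ := φ) e1).deriv_eq,
      (hφ.hasDerivAt_weighted hd hne).deriv, hd.deriv, localForm, matVec_smul, tangent_smul,
      sprod_smul_left, sprod_smul_right, Complex.re_ofReal_mul]
    ring
  rw [← h1, ← h2, hsplit, Complex.sub_re]
  linarith

/-! ### Continuity and integrability of the local form -/

theorem Admissible.continuousOn_tangent {φ : ℝ → ℝ} (hφ : Admissible φ) :
    ContinuousOn (fun p : Cvec m × Cvec m => tangent φ p.1 p.2) {p | p.1 ≠ 0} := by
  have hn : ContinuousOn (fun p : Cvec m × Cvec m => ‖p.1‖) {p | p.1 ≠ 0} :=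
    (continuous_norm.comp continuous_fst).continuousOn
  have hmaps : MapsTo (fun p : Cvec m × Cvec m => ‖p.1‖) {p | p.1 ≠ 0} (Ioi 0) := fun p hp =>
    norm_pos_iff.mpr hp
  have hs : Continuous fun p : Cvec m × Cvec m => (sprod p.2 p.1).re :=
    Complex.continuous_re.comp (continuous_fst.inner continuous_snd)
  exact ((hφ.contDiffOn.continuousOn.comp hn hmaps).smul continuous_snd.continuousOn).add
    ((((hφ.continuousOn_deriv.comp hn hmaps).div hn fun p hp => norm_ne_zero_iff.mpr hp).mul
      hs.continuousOn).smul continuous_fst.continuousOn)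

theorem Admissible.continuousOn_tangent_left {φ : ℝ → ℝ} (hφ : Admissible φ) (v : Cvec m) :
    ContinuousOn (fun z : Cvec m => tangent φ z v) {0}ᶜ := by
  have h : ContinuousOn (fun z : Cvec m => (z, v)) {0}ᶜ := by fun_prop
  have ht := hφ.continuousOn_tangent (m := m)
  have := ContinuousOn.comp ht h fun z hz => hz
  exact this

theorem continuous_re_sprod_matVec (M : Matrix (Fin m) (Fin m) ℂ) :
    Continuous fun p : Cvec m × Cvec m => (sprod (matVec M p.1) p.2).re := by
  simp only [sprod_matVec_eq_sum]
  fun_prop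

theorem Admissible.continuousOn_localForm {φ : ℝ → ℝ} (hφ : Admissible φ)
    (𝒜 : ℝ → Matrix (Fin m) (Fin m) ℂ) (x : ℝ) :
    ContinuousOn (fun p : Cvec m × Cvec m => localForm φ 𝒜 p.2 p.1 x) {p | p.1 ≠ 0} := by
  have ht := hφ.continuousOn_tangent (m := m)
  have h := (continuousOn_snd (s := {p : Cvec m × Cvec m | p.1 ≠ 0})).prodMk ht
  have := (continuous_re_sprod_matVec (𝒜 x)).comp_continuousOn h
  exact this

theorem integrableOn_mul_localForm {φ : ℝ → ℝ} (hφ : Admissible φ) {I : Set ℝ}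
    {𝒜 : ℝ → Matrix (Fin m) (Fin m) ℂ}
    (h𝒜 : ∀ i j, LocallyIntegrableOn (fun x => 𝒜 x i j) I volume) {K : Set ℝ} (hK : IsCompact K)
    (hKI : K ⊆ I) {f : ℝ → ℝ} {u : ℝ → Cvec m} (hf : Continuous f) (hu : Continuous u)
    (hu0 : ∀ x, u x ≠ 0) (v : Cvec m) :
    IntegrableOn (fun x => f x * localForm φ 𝒜 v (u x) x) K := by
  have ht : Continuous fun x => tangent φ (u x) v := by
    have h := hφ.continuousOn_tangent_left v
    exact h.comp_continuous hu hu0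
  have := (integrableOn_sprod_matVec h𝒜 hK hKI (f := fun _ => v)
    (g := fun x => f x • tangent φ (u x) v) continuousOn_const (hf.smul ht).continuousOn).re
  refine this.congr (Eventually.of_forall fun x => ?_)
  simp only [sprod_smul_right, RCLike.re_to_complex, Complex.re_ofReal_mul, localForm]

theorem abs_localForm_le (φ : ℝ → ℝ) (𝒜 : ℝ → Matrix (Fin m) (Fin m) ℂ) (v z : Cvec m) (x : ℝ) :
    |localForm φ 𝒜 v z x| ≤ entrySum (𝒜 x) * (‖v‖ * ‖tangent φ z v‖) :=
  (Complex.abs_re_le_norm _).trans (norm_sprod_matVec_le _ _ _)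

/-! ### Oscillating perturbations -/

/-- A cut-off oscillation with frequency `n²` and amplitude `1 / n`. -/
def oscillation (ζ : ℝ → ℝ) (α : ℝ) (n : ℕ) (x : ℝ) : ℝ :=
  (n : ℝ)⁻¹ * (ζ x * Real.cos ((n : ℝ) ^ 2 * x + α))

/-- The derivative of the oscillation, divided by `n`. -/
def oscillationSlope (ζ : ℝ → ℝ) (α : ℝ) (n : ℕ) (x : ℝ) : ℝ :=
  ((n : ℝ)⁻¹) ^ 2 * (deriv ζ x * Real.cos ((n : ℝ) ^ 2 * x + α))
    - ζ x * Real.sin ((n : ℝ) ^ 2 * x + α)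

section oscillation

variable {ζ : ℝ → ℝ} {α : ℝ} {n : ℕ}

theorem contDiff_oscillation (hζ : ContDiff ℝ 1 ζ) : ContDiff ℝ 1 (oscillation ζ α n) := by
  unfold oscillation
  fun_prop

theorem continuous_oscillationSlope (hζ : ContDiff ℝ 1 ζ) :
    Continuous (oscillationSlope ζ α n) := by
  have := hζ.continuous
  have := hζ.continuous_deriv le_rfl
  unfold oscillationSlope
  fun_prop

theorem deriv_oscillation (hζ : ContDiff ℝ 1 ζ) (hn : n ≠ 0) (x : ℝ) :
    deriv (oscillation ζ α n) x = n * oscillationSlope ζ α n x := by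
  have hn' : (n : ℝ) ≠ 0 := Nat.cast_ne_zero.mpr hn
  have h1 : HasDerivAt (fun x : ℝ => (n : ℝ) ^ 2 * x + α) ((n : ℝ) ^ 2) x := by
    simpa using ((hasDerivAt_id x).const_mul ((n : ℝ) ^ 2)).add_const α
  have h2 := (((hζ.differentiable one_ne_zero) x).hasDerivAt.mul h1.cos).const_mul (n : ℝ)⁻¹
  have h3 : deriv (oscillation ζ α n) x = _ := h2.deriv
  rw [h3, oscillationSlope]
  field_simp
  ring

theorem tsupport_oscillation_subset : tsupport (oscillation ζ α n) ⊆ tsupport ζ := by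
  refine closure_mono fun x hx h => hx ?_
  simp [oscillation, h]

theorem abs_oscillation_le {C : ℝ} {x : ℝ} (hC : |ζ x| ≤ C) :
    |oscillation ζ α n x| ≤ (n : ℝ)⁻¹ * C := by
  rw [oscillation, abs_mul, abs_mul, abs_of_nonneg (by positivity : (0 : ℝ) ≤ (n : ℝ)⁻¹)]
  gcongr
  exact (mul_le_of_le_one_right (abs_nonneg _) (Real.abs_cos_le_one _)).trans hC

theorem abs_oscillationSlope_le {C : ℝ} {x : ℝ} (hn : n ≠ 0) (hC : |ζ x| ≤ C)
    (hC' : |deriv ζ x| ≤ C) : |oscillationSlope ζ α n x| ≤ 2 * C := by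
  have hn1 : (n : ℝ)⁻¹ ≤ 1 := Nat.cast_inv_le_one n
  have h0 : (0 : ℝ) ≤ (n : ℝ)⁻¹ := by positivity
  have h1 : ((n : ℝ)⁻¹) ^ 2 ≤ 1 := pow_le_one₀ h0 hn1
  have h2 : |ζ x * Real.sin ((n : ℝ) ^ 2 * x + α)| ≤ C := by
    rw [abs_mul]
    exact (mul_le_of_le_one_right (abs_nonneg _) (Real.abs_sin_le_one _)).trans hC
  have h3 : |deriv ζ x * Real.cos ((n : ℝ) ^ 2 * x + α)| ≤ C := by
    rw [abs_mul]
    exact (mul_le_of_le_one_right (abs_nonneg _) (Real.abs_cos_le_one _)).trans hC'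
  have h4 : |((n : ℝ)⁻¹) ^ 2 * (deriv ζ x * Real.cos ((n : ℝ) ^ 2 * x + α))| ≤ C := by
    rw [abs_mul, abs_of_nonneg (by positivity : (0 : ℝ) ≤ ((n : ℝ)⁻¹) ^ 2)]
    exact (mul_le_of_le_one_left (abs_nonneg _) h1).trans h3
  exact (abs_sub _ _).trans (by linarith)

/-- Two phases a quarter period apart add up to a nonoscillating quantity, so pointwise convergence
replaces a weak limit of `sin²`. -/
theorem oscillationSlope_sq_add_sq (ζ : ℝ → ℝ) (n : ℕ) (x : ℝ) :
    oscillationSlope ζ 0 n x ^ 2 + oscillationSlope ζ (Real.pi / 2) n x ^ 2 =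
      ζ x ^ 2 + ((n : ℝ)⁻¹) ^ 4 * deriv ζ x ^ 2 := by
  simp only [oscillationSlope, Real.cos_add_pi_div_two, Real.sin_add_pi_div_two, add_zero]
  have := Real.sin_sq_add_cos_sq ((n : ℝ) ^ 2 * x)
  linear_combination (ζ x ^ 2 + ((n : ℝ)⁻¹) ^ 4 * deriv ζ x ^ 2) * this

end oscillation

theorem tendsto_sq_mul_add_sq_mul {g₀ g₁ b₀ b₁ : ℕ → ℝ} {C a b : ℝ} (h₀ : ∀ᶠ n in atTop, |g₀ n| ≤ C)
    (h₁ : ∀ᶠ n in atTop, |g₁ n| ≤ C) (hb₀ : Tendsto b₀ atTop (𝓝 b)) (hb₁ : Tendsto b₁ atTop (𝓝 b))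
    (h : Tendsto (fun n => g₀ n ^ 2 + g₁ n ^ 2) atTop (𝓝 a)) :
    Tendsto (fun n => g₀ n ^ 2 * b₀ n + g₁ n ^ 2 * b₁ n) atTop (𝓝 (a * b)) := by
  have aux : ∀ {g β : ℕ → ℝ}, (∀ᶠ n in atTop, |g n| ≤ C) → Tendsto β atTop (𝓝 b) →
      Tendsto (fun n => g n ^ 2 * (β n - b)) atTop (𝓝 0) := by
    intro g β hg hβ
    have h2 : Tendsto (fun n => C ^ 2 * |β n - b|) atTop (𝓝 0) := by
      simpa using ((hβ.sub_const b).abs.const_mul (C ^ 2))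
    refine squeeze_zero_norm' ?_ h2
    filter_upwards [hg] with n hn
    rw [norm_mul, Real.norm_eq_abs, Real.norm_eq_abs, abs_pow]
    gcongr
  have := ((aux h₀ hb₀).add (aux h₁ hb₁)).add (h.mul_const b)
  rw [zero_add, zero_add] at this
  exact this.congr fun n => by ring

/-- Insert `S = oscillation ζ α n` and divide by `n²`: the constant `E` disappears in the limit, and
`z + S v → z`. Summing over the phases `0` and `π / 2` leaves the weight `ζ²`. -/
theorem IsDissipative.setIntegral_sq_mul_localForm_nonneg {φ : ℝ → ℝ} (hφ : Admissible φ)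
    {I : Set ℝ} (hI : MeasurableSet I) {𝒜 : ℝ → Matrix (Fin m) (Fin m) ℂ}
    (h𝒜 : ∀ i j, LocallyIntegrableOn (fun x => 𝒜 x i j) I volume) (hdiss : IsDissipative φ I 𝒜)
    {c ρ ρ' : ℝ} (hρ : 0 < ρ) (hρρ' : ρ < ρ') (hρI : Metric.closedBall c ρ' ⊆ I) {z : Cvec m}
    (hz : z ≠ 0) (v : Cvec m) {ζ : ℝ → ℝ} (hζ : ContDiff ℝ 1 ζ)
    (hζs : tsupport ζ ⊆ Metric.closedBall c ρ) :
    0 ≤ ∫ x in Metric.closedBall c ρ, ζ x ^ 2 * localForm φ 𝒜 v z x := by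
  obtain ⟨E, hE⟩ := hdiss.exists_le_setIntegral hφ hI h𝒜 hρ hρρ' hρI hz v
  set K := Metric.closedBall c ρ with hKdef
  have hK : IsCompact K := isCompact_closedBall c ρ
  have hKI : K ⊆ I := (Metric.closedBall_subset_closedBall hρρ'.le).trans hρI
  have hcs : HasCompactSupport ζ := hK.of_isClosed_subset (isClosed_tsupport ζ) hζs
  obtain ⟨C, hC, hC'⟩ : ∃ C : ℝ, (∀ x, |ζ x| ≤ C) ∧ ∀ x, |deriv ζ x| ≤ C := by
    obtain ⟨C₁, h₁⟩ := hcs.exists_bound_of_continuous hζ.continuous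
    obtain ⟨C₂, h₂⟩ := hcs.deriv.exists_bound_of_continuous (hζ.continuous_deriv le_rfl)
    exact ⟨max C₁ C₂, fun x => (h₁ x).trans (le_max_left _ _),
      fun x => (h₂ x).trans (le_max_right _ _)⟩
  have hC0 : 0 ≤ C := (abs_nonneg _).trans (hC 0)
  have hzn : 0 < ‖z‖ := norm_pos_iff.mpr hz
  obtain ⟨T, hT⟩ : ∃ T : ℝ, ∀ y ∈ Metric.closedBall z (‖z‖ / 2), ‖tangent φ y v‖ ≤ T := by
    refine (isCompact_closedBall z (‖z‖ / 2)).exists_bound_of_continuousOn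
      ((hφ.continuousOn_tangent_left v).mono ?_)
    intro y hy h0
    have h0 : y = 0 := h0
    rw [h0, mem_closedBall_iff_norm', sub_zero] at hy
    linarith
  have hinv : Tendsto (fun n : ℕ => (n : ℝ)⁻¹) atTop (𝓝 0) := tendsto_inv_atTop_nhds_zero_nat
  have hsmall : ∀ᶠ n : ℕ in atTop, (n : ℝ)⁻¹ * C * ‖v‖ < ‖z‖ / 2 := by
    have : Tendsto (fun n : ℕ => (n : ℝ)⁻¹ * C * ‖v‖) atTop (𝓝 0) := by
      simpa using (hinv.mul_const C).mul_const ‖v‖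
    exact this.eventually_lt_const (by positivity)
  have hosc : ∀ᶠ n : ℕ in atTop, ∀ α x, |oscillation ζ α n x| * ‖v‖ < ‖z‖ / 2 := by
    filter_upwards [hsmall] with n hn α x
    exact (mul_le_mul_of_nonneg_right (abs_oscillation_le (hC x)) (norm_nonneg v)).trans_lt hn
  let F : ℝ → ℕ → ℝ → ℝ := fun α n x =>
    oscillationSlope ζ α n x ^ 2 * localForm φ 𝒜 v (z + oscillation ζ α n x • v) x
  have hFint : ∀ᶠ n : ℕ in atTop, ∀ α, IntegrableOn (F α n) K := by
    filter_upwards [hosc] with n hn α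
    exact integrableOn_mul_localForm hφ h𝒜 hK hKI ((continuous_oscillationSlope hζ).pow 2)
      (continuous_const.add ((contDiff_oscillation hζ).continuous.smul continuous_const))
      (fun x => add_smul_ne_zero_of_lt ((hn α x).trans (half_lt_self hzn))) v
  have hFnn : ∀ᶠ n : ℕ in atTop, ∀ α, 0 ≤ ((n : ℝ)⁻¹) ^ 2 * E + ∫ x in K, F α n x := by
    filter_upwards [hosc, eventually_ne_atTop 0] with n hn hn0 α
    have h := hE (oscillation ζ α n) (contDiff_oscillation hζ)
      (tsupport_oscillation_subset.trans hζs) fun x => (hn α x).trans (half_lt_self hzn)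
    have e : ∀ x, deriv (oscillation ζ α n) x ^ 2 *
        localForm φ 𝒜 v (z + oscillation ζ α n x • v) x = (n : ℝ) ^ 2 * F α n x := fun x => by
      rw [deriv_oscillation hζ hn0]
      ring
    simp only [e, integral_const_mul] at h
    have hn' : (n : ℝ) ≠ 0 := Nat.cast_ne_zero.mpr hn0
    have h2 : ((n : ℝ)⁻¹) ^ 2 * (E + (n : ℝ) ^ 2 * ∫ x in K, F α n x) =
        ((n : ℝ)⁻¹) ^ 2 * E + ∫ x in K, F α n x := by field_simp
    rw [← h2]
    positivity
  have hFle : ∀ᶠ n : ℕ in atTop, ∀ α x,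
      |F α n x| ≤ (2 * C) ^ 2 * (entrySum (𝒜 x) * (‖v‖ * T)) := by
    filter_upwards [hosc, eventually_ne_atTop 0] with n hn hn0 α x
    have hy : z + oscillation ζ α n x • v ∈ Metric.closedBall z (‖z‖ / 2) := by
      rw [mem_closedBall_iff_norm, add_sub_cancel_left, norm_smul, Real.norm_eq_abs]
      exact (hn α x).le
    have hes : 0 ≤ entrySum (𝒜 x) :=
      Finset.sum_nonneg fun i _ => Finset.sum_nonneg fun j _ => norm_nonneg _
    simp only [F, abs_mul, abs_pow]
    gcongr
    · exact abs_oscillationSlope_le hn0 (hC x) (hC' x)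
    · refine (abs_localForm_le _ _ _ _ _).trans ?_
      gcongr
      exact hT _ hy
  have hlim : Tendsto (fun n => ∫ x in K, (F 0 n x + F (Real.pi / 2) n x)) atTop
      (𝓝 (∫ x in K, ζ x ^ 2 * localForm φ 𝒜 v z x)) := by
    refine tendsto_integral_filter_of_dominated_convergence
      (fun x => 2 * ((2 * C) ^ 2 * (entrySum (𝒜 x) * (‖v‖ * T)))) ?_ ?_ ?_ ?_
    · filter_upwards [hFint] with n hn
      exact ((hn 0).add (hn _)).aestronglyMeasurable
    · filter_upwards [hFle] with n hn
      refine Eventually.of_forall fun x => (norm_add_le _ _).trans ?_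
      rw [two_mul]
      exact add_le_add (hn 0 x) (hn _ x)
    · exact (((integrableOn_entrySum h𝒜 hK hKI).mul_const _).const_mul _).const_mul _
    · refine Eventually.of_forall fun x => ?_
      have hslope : ∀ α, ∀ᶠ n : ℕ in atTop, |oscillationSlope ζ α n x| ≤ 2 * C := fun α => by
        filter_upwards [eventually_ne_atTop 0] with n hn
        exact abs_oscillationSlope_le hn (hC x) (hC' x)
      have hform : ∀ α, Tendsto (fun n => localForm φ 𝒜 v (z + oscillation ζ α n x • v) x) atTop
          (𝓝 (localForm φ 𝒜 v z x)) := fun α => by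
        have h1 : Tendsto (fun n => oscillation ζ α n x) atTop (𝓝 0) :=
          squeeze_zero_norm (fun n => abs_oscillation_le (hC x)) (by simpa using hinv.mul_const C)
        have h2 : Tendsto (fun n => (z + oscillation ζ α n x • v, v)) atTop (𝓝 (z, v)) := by
          refine Tendsto.prodMk_nhds ?_ tendsto_const_nhds
          simpa using (h1.smul_const v).const_add z
        have hopen : {p : Cvec m × Cvec m | p.1 ≠ 0} ∈ 𝓝 (z, v) :=
          (isOpen_ne.preimage continuous_fst).mem_nhds hz
        have h3 := (hφ.continuousOn_localForm 𝒜 x).continuousAt hopen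
        have h4 := h3.tendsto.comp h2
        exact h4
      refine tendsto_sq_mul_add_sq_mul (hslope 0) (hslope _) (hform 0) (hform _) ?_
      simp only [oscillationSlope_sq_add_sq]
      simpa using ((hinv.pow 4).mul_const (deriv ζ x ^ 2)).const_add (ζ x ^ 2)
  have hE0 : Tendsto (fun n : ℕ => 2 * (((n : ℝ)⁻¹) ^ 2 * E)) atTop (𝓝 0) := by
    simpa using ((hinv.pow 2).mul_const E).const_mul 2
  have hfin := hE0.add hlim
  rw [zero_add] at hfin
  refine ge_of_tendsto hfin ?_
  filter_upwards [hFint, hFnn] with n hn hnn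
  rw [integral_add (hn 0) (hn _)]
  linarith [hnn 0, hnn (Real.pi / 2)]

/-! ### From integrals to almost every point -/

theorem IsDissipative.setIntegral_localForm_nonneg {φ : ℝ → ℝ} (hφ : Admissible φ)
    {I : Set ℝ} (hI : MeasurableSet I) {𝒜 : ℝ → Matrix (Fin m) (Fin m) ℂ}
    (h𝒜 : ∀ i j, LocallyIntegrableOn (fun x => 𝒜 x i j) I volume) (hdiss : IsDissipative φ I 𝒜)
    {c ρ ρ' : ℝ} (hρ : 0 < ρ) (hρρ' : ρ < ρ') (hρI : Metric.closedBall c ρ' ⊆ I) {z : Cvec m}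
    (hz : z ≠ 0) (v : Cvec m) :
    0 ≤ ∫ x in Metric.closedBall c ρ, localForm φ 𝒜 v z x := by
  set σ := (ρ + ρ') / 2 with hσ
  have hρσ : ρ < σ := by linarith
  have hσρ' : σ < ρ' := by linarith
  have hKI : Metric.closedBall c σ ⊆ I := (Metric.closedBall_subset_closedBall hσρ'.le).trans hρI
  have hδ : ∀ n : ℕ, 0 < (σ - ρ) / (n + 1) := fun n => div_pos (by linarith) (by positivity)
  -- Bumps decreasing to the indicator of the closed ball of radius `ρ`, all supported in the ball
  -- of radius `σ < ρ'`.
  let ζ : ℕ → ContDiffBump c := fun n => ⟨ρ, ρ + (σ - ρ) / (n + 1), hρ, by linarith [hδ n]⟩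
  have hζn : ∀ n, 0 ≤ ∫ x in Metric.closedBall c σ, ζ n x ^ 2 * localForm φ 𝒜 v z x := fun n => by
    refine hdiss.setIntegral_sq_mul_localForm_nonneg hφ hI h𝒜 (hρ.trans hρσ) hσρ' hρI hz v
      (ζ n).contDiff ?_
    rw [(ζ n).tsupport_eq]
    refine Metric.closedBall_subset_closedBall ?_
    have : (σ - ρ) / (n + 1) ≤ σ - ρ :=
      div_le_self (by linarith) (by linarith [n.cast_nonneg (α := ℝ)])
    show ρ + (σ - ρ) / (n + 1) ≤ σ
    linarith
  have hint := integrableOn_mul_localForm hφ h𝒜 (isCompact_closedBall c σ) hKI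
    (f := fun _ => 1) (u := fun _ => z) continuous_const continuous_const (fun _ => hz) v
  simp only [one_mul] at hint
  have hlim : Tendsto (fun n => ∫ x in Metric.closedBall c σ, ζ n x ^ 2 * localForm φ 𝒜 v z x) atTop
      (𝓝 (∫ x in Metric.closedBall c σ,
        (Metric.closedBall c ρ).indicator (fun x => localForm φ 𝒜 v z x) x)) := by
    refine tendsto_integral_filter_of_dominated_convergence
      (fun x => ‖localForm φ 𝒜 v z x‖) ?_ ?_ hint.norm ?_
    · exact Eventually.of_forall fun n =>
        ((ζ n).continuous.pow 2).aestronglyMeasurable.mul hint.aestronglyMeasurable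
    · refine Eventually.of_forall fun n => Eventually.of_forall fun x => ?_
      rw [norm_mul, norm_pow, Real.norm_of_nonneg (ζ n).nonneg]
      exact mul_le_of_le_one_left (norm_nonneg _) (pow_le_one₀ (ζ n).nonneg (ζ n).le_one)
    · refine Eventually.of_forall fun x => ?_
      by_cases hx : x ∈ Metric.closedBall c ρ
      · rw [indicator_of_mem hx]
        refine tendsto_const_nhds.congr fun n => ?_
        rw [(ζ n).one_of_mem_closedBall hx, one_pow, one_mul]
      · rw [indicator_of_notMem hx]
        have hx' : 0 < dist x c - ρ := by
          rw [Metric.mem_closedBall, not_le] at hx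
          linarith
        have h1 : Tendsto (fun n : ℕ => (σ - ρ) / ((n : ℝ) + 1)) atTop (𝓝 0) :=
          (tendsto_const_div_atTop_nhds_zero_nat (σ - ρ)).comp (tendsto_add_atTop_nat 1) |>.congr
            fun n => by simp
        refine tendsto_const_nhds.congr' ?_
        filter_upwards [h1.eventually_lt_const hx'] with n hn
        rw [(ζ n).zero_of_le_dist (show ρ + (σ - ρ) / (n + 1) ≤ dist x c by linarith)]
        simp
  have h := ge_of_tendsto' hlim hζn
  rwa [setIntegral_indicator Metric.isClosed_closedBall.measurableSet,
    inter_eq_self_of_subset_right (Metric.closedBall_subset_closedBall hρσ.le)] at h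

theorem IsDissipative.ae_localForm_nonneg {φ : ℝ → ℝ} (hφ : Admissible φ)
    {I : Set ℝ} (hI : IsOpen I) {𝒜 : ℝ → Matrix (Fin m) (Fin m) ℂ}
    (h𝒜 : ∀ i j, LocallyIntegrableOn (fun x => 𝒜 x i j) I volume) (hdiss : IsDissipative φ I 𝒜)
    {z : Cvec m} (hz : z ≠ 0) (v : Cvec m) :
    ∀ᵐ x : ℝ, x ∈ I → 0 ≤ localForm φ 𝒜 v z x := by
  have hnull : volume {x | x ∈ I ∧ ¬ 0 ≤ localForm φ 𝒜 v z x} = 0 := by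
    refine measure_null_of_locally_null _ fun x hx => ?_
    obtain ⟨ε, hε, hεI⟩ := Metric.isOpen_iff.mp hI x hx.1
    have hKI : Metric.closedBall x (ε / 2) ⊆ I :=
      (Metric.closedBall_subset_ball (by linarith)).trans hεI
    refine ⟨Metric.ball x (ε / 2) ∩ {x | x ∈ I ∧ ¬ 0 ≤ localForm φ 𝒜 v z x},
      inter_mem (mem_nhdsWithin_of_mem_nhds (Metric.ball_mem_nhds _ (by linarith)))
        self_mem_nhdsWithin, ?_⟩
    have hint := integrableOn_mul_localForm hφ h𝒜 (isCompact_closedBall x (ε / 2)) hKI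
      (f := fun _ => 1) (u := fun _ => z) continuous_const continuous_const (fun _ => hz) v
    simp only [one_mul] at hint
    -- Extension by zero from a compact ball gives a locally integrable function on all of `ℝ`, as
    -- Lebesgue differentiation requires.
    have hloc :=
      (hint.integrable_indicator Metric.isClosed_closedBall.measurableSet).locallyIntegrable
    have hae := IsUnifLocDoublingMeasure.ae_tendsto_average volume hloc 1
    refine measure_mono_null ?_ hae
    rintro y ⟨hy, hyI, hneg⟩ hav
    apply hneg
    have hδ : Tendsto (fun t : ℝ => t) (𝓝[>] 0) (𝓝[>] 0) := tendsto_id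
    have hlim := hav (fun _ : ℝ => y) (fun t => t) hδ (by
      filter_upwards [self_mem_nhdsWithin] with t ht
      have : (0 : ℝ) < t := ht
      exact Metric.mem_closedBall_self (by linarith))
    rw [indicator_of_mem (Metric.ball_subset_closedBall hy)] at hlim
    refine ge_of_tendsto hlim ?_
    obtain ⟨τ, hτ, hτI⟩ := Metric.isOpen_iff.mp Metric.isOpen_ball y hy
    filter_upwards [Ioo_mem_nhdsGT (show 0 < τ / 2 by linarith)] with t ht
    have hsub : Metric.closedBall y (τ / 2) ⊆ Metric.closedBall x (ε / 2) :=
      (Metric.closedBall_subset_ball (by linarith)).trans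
        (hτI.trans Metric.ball_subset_closedBall)
    have h0 := hdiss.setIntegral_localForm_nonneg hφ hI.measurableSet h𝒜 ht.1 ht.2
      (hsub.trans hKI) hz v
    have e : ∫ w in Metric.closedBall y t, (Metric.closedBall x (ε / 2)).indicator
        (fun w => localForm φ 𝒜 v z w) w = ∫ w in Metric.closedBall y t, localForm φ 𝒜 v z w :=
      setIntegral_congr_fun Metric.isClosed_closedBall.measurableSet fun w hw =>
        indicator_of_mem (hsub (Metric.closedBall_subset_closedBall ht.2.le hw)) _
    rw [setAverage_eq, e, smul_eq_mul]
    positivity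
  rw [ae_iff]
  simpa only [Classical.not_imp] using hnull

/-- The exceptional null set depends on `(z, v)`; a countable dense set of pairs, with continuity in
`(z, v)` for fixed `x`, makes it uniform. -/
theorem IsDissipative.ae_forall_localForm_nonneg {φ : ℝ → ℝ} (hφ : Admissible φ)
    {I : Set ℝ} (hI : IsOpen I) {𝒜 : ℝ → Matrix (Fin m) (Fin m) ℂ}
    (h𝒜 : ∀ i j, LocallyIntegrableOn (fun x => 𝒜 x i j) I volume) (hdiss : IsDissipative φ I 𝒜) :
    ∀ᵐ x : ℝ, x ∈ I → ∀ z v : Cvec m, z ≠ 0 → 0 ≤ localForm φ 𝒜 v z x := by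
  obtain ⟨D, hD, hDd⟩ := TopologicalSpace.exists_countable_dense (Cvec m × Cvec m)
  have hall : ∀ᵐ x : ℝ, ∀ p ∈ D, p.1 ≠ 0 → x ∈ I → 0 ≤ localForm φ 𝒜 p.2 p.1 x := by
    rw [ae_ball_iff hD]
    intro p _
    by_cases hp : p.1 = 0
    · simp [hp]
    · filter_upwards [hdiss.ae_localForm_nonneg hφ hI h𝒜 hp p.2] with x hx _ using hx
  filter_upwards [hall] with x hx hxI z v hz
  have hopen : IsOpen {p : Cvec m × Cvec m | p.1 ≠ 0} := isOpen_ne.preimage continuous_fst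
  have hmem : (z, v) ∈ closure (D ∩ {p : Cvec m × Cvec m | p.1 ≠ 0}) := by
    rw [inter_comm]
    exact hDd.open_subset_closure_inter hopen hz
  have hnhds : {p : Cvec m × Cvec m | p.1 ≠ 0} ∈ 𝓝 (z, v) := hopen.mem_nhds hz
  have hcont := ((hφ.continuousOn_localForm 𝒜 x).continuousAt hnhds).continuousWithinAt
    (s := D ∩ {p : Cvec m × Cvec m | p.1 ≠ 0})
  have := hcont.mem_closure hmem (t := Ici 0) fun p hp => hx p hp.1 hp.2 hxI
  rwa [isClosed_Ici.closure_eq] at this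

end FunctionalDissipativity

end

theorem mainTheorem4 (φ : ℝ → ℝ) (hφ : FunctionalDissipativity.Admissible φ)
    (a b : EReal) (m : ℕ) (𝒜 : ℝ → Matrix (Fin m) (Fin m) ℂ)
    (h𝒜 : ∀ i j, LocallyIntegrableOn (fun x => 𝒜 x i j)
      (FunctionalDissipativity.openInterval a b) volume) :
    ∃ Λinf : ℝ, Tendsto (FunctionalDissipativity.Lambda φ) atTop (𝓝 Λinf) ∧
      (FunctionalDissipativity.IsDissipative φ (FunctionalDissipativity.openInterval a b) 𝒜 ↔
        ∀ᵐ x : ℝ, x ∈ FunctionalDissipativity.openInterval a b →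
          ∀ l ω : FunctionalDissipativity.Cvec m, ‖ω‖ = 1 →
            0 ≤ (FunctionalDissipativity.sprod (FunctionalDissipativity.matVec (𝒜 x) l) l).re
              - Λinf ^ 2
                * (FunctionalDissipativity.sprod (FunctionalDissipativity.matVec (𝒜 x) ω) ω).re
                * (FunctionalDissipativity.sprod l ω).re ^ 2
              + Λinf
                * (FunctionalDissipativity.sprod (FunctionalDissipativity.matVec (𝒜 x) ω) l
                  - FunctionalDissipativity.sprod (FunctionalDissipativity.matVec (𝒜 x) l) ω).re
                * (FunctionalDissipativity.sprod l ω).re) := by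
  obtain ⟨L, hL, hseg⟩ := hφ.exists_tendsto_lambdaOfIndex
  have hI := FunctionalDissipativity.isOpen_openInterval a b
  refine ⟨L, hφ.tendsto_Lambda hL, fun hdiss => ?_, fun h =>
    FunctionalDissipativity.isDissipative_of_dissForm_nonneg hφ hseg hI.measurableSet h𝒜 h⟩
  filter_upwards [hdiss.ae_forall_localForm_nonneg hφ hI h𝒜] with x hx hxI l ω hω
  exact FunctionalDissipativity.dissForm_nonneg_of_tangent hφ hL (hx hxI) l hω
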